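/- Let $\mathcal H$ be a separable complex Hilbert space and let $T_i\in B(\mathcal H)$, $i=1,\dots,n$ ($n\in\{1,2,\dots\}$ or $n=\infty$), be such that $$\varphi_T(X):=\sum_{i=1}^n T_iXT_i^*,\qquad X\in B(\mathcal H),$$ defines a $w^*$-continuous completely positive map (the series converging in the $w^*$-topology if $n=\infty$) with $\varphi_T(I)\le I$. Let $[V_1,V_2,\dots]$ be the minimal isometric dilation of $[T_1,T_2,\dots]$ on a Hilbert space $\mathcal K\supseteq\mathcal H$: the $V_i\in B(\mathcal K)$ are isometries with $V_i^*V_j=0$ for $i\ne j$, $V_i^*|_{\mathcal H}=T_i^*$, and $\mathcal K$ is the closed linear span of the spaces $V_{i_1}\cdots V_{i_k}\mathcal H$, $k\ge 0$. Put $\varphi_V(Y):=\sum_i V_iYV_i^*$, $Y\in B(\mathcal K)$, and let $P_{\mathcal H}$ be the orthogonal projection of $\mathcal K$ onto $\mathcal H$. Let $S_i$, $S_if=e_i\otimes f$, be the left creation operators on the full Fock space $F^2(H_n)=\bigoplus_{k\ge0}H_n^{\otimes k}$ of an $n$-dimensional Hilbert space $H_n$ with orthonormal basis $(e_i)$. For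 every $B\in B(\mathcal K)$ in the commutant of $\{V_i,V_i^*\}_i$ the limit $\text{SOT-}\lim_{k\to\infty}\varphi_V^k(B)$ exists. A positive operator $A\in B(\mathcal H)$ is a solution of $\varphi_T(X)\le X$ if and only if there exist (i) an operator $B\in B(\mathcal K)$ in the commutant of $\{V_i,V_i^*\}_i$, and (ii) a Hilbert space $\mathcal D$ and a bounded operator $K:\mathcal K\to F^2(H_n)\otimes\mathcal D$ with $V_iK^*=K^*(S_i\otimes I_{\mathcal D})$ for all $i$, such that $$A=P_{\mathcal H}A_1|_{\mathcal H}+P_{\mathcal H}A_2|_{\mathcal H},\qquad \|A\|=\|A_1+A_2\|,\qquad(*)$$ where $A_1:=\text{SOT-}\lim_{k\to\infty}\varphi_V^k(B)$ and $A_2:=K^*K$. Moreover, for every positive $A\in B(\mathcal H)$ and all $B$, $\mathcal D$, $K$ as in (i) and (ii) that satisfy $(*)$, the decomposition in $(*)$ is the canonical decomposition of $A$ with respect to $\varphi_T$: the pair $(A',A'')=(P_{\mathcal H}A_1|_{\mathcal H},\,P_{\mathcal H}A_2|_{\mathcal H})$ is the unique pair of operators in $B(\mathcal H)$ such that $A=A'+A''$,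 $A'=A'^*$, $\varphi_T(A')=A'$, $A''\ge0$, $\varphi_T(A'')\le A''$ and $\text{SOT-}\lim_{k\to\infty}\varphi_T^k(A'')=0$. -/

import Mathlib

open Filter Topology ContinuousLinearMap

universe u v w x

noncomputable section

namespace CPMap

/-! ### The full Fock space with multiplicity space -/

/-- The Hilbert space `F²(Hₙ) ⊗ D`, where `Hₙ` has an orthonormal basis `(eᵢ)` indexed by `ι`.
The full Fock space `F²(Hₙ) = ⨁ₖ Hₙ^{⊗k}` has the orthonormal basis `e_α`, `α` a word of the free
semigroup `FreeMonoid ι`, so that `F²(Hₙ) ⊗ D` is the space of all square-summable families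
`(d_α)` in `D`, the family `(d_α)` being the vector `∑ e_α ⊗ d_α`. -/
abbrev Fock (ι : Type u) (D : Type v) [NormedAddCommGroup D] : Type (max u v) :=
  lp (fun _ : FreeMonoid ι => D) 2

section Creation

variable {ι : Type u} {D : Type v} [NormedAddCommGroup D]

lemma of_mul_injective (i : ι) :
    Function.Injective (fun α : FreeMonoid ι => FreeMonoid.of i * α) := by
  intro a b h
  exact mul_left_cancel h

/-- The coordinates of `(Sᵢ ⊗ I) f`: the one at the word `gᵢ α` is `f α`, all others are `0`. -/
def creationFun (i : ι) (f : FreeMonoid ι → D) : FreeMonoid ι → D :=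
  Function.extend (fun α => FreeMonoid.of i * α) f 0

lemma norm_rpow_creationFun (i : ι) (f : FreeMonoid ι → D) :
    (fun w => ‖creationFun i f w‖ ^ (2 : ENNReal).toReal) =
      Function.extend (fun α => FreeMonoid.of i * α)
        (fun α => ‖f α‖ ^ (2 : ENNReal).toReal) 0 := by
  funext w
  by_cases h : ∃ α, FreeMonoid.of i * α = w
  · obtain ⟨α, rfl⟩ := h
    simp only [creationFun]
    rw [(of_mul_injective i).extend_apply, (of_mul_injective i).extend_apply]
  · simp only [creationFun]
    rw [Function.extend_apply' _ _ _ h, Function.extend_apply' _ _ _ h]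
    simp

lemma creationFun_add (i : ι) (f g : FreeMonoid ι → D) :
    creationFun i (f + g) = creationFun i f + creationFun i g := by
  funext w
  by_cases h : ∃ α, FreeMonoid.of i * α = w
  · obtain ⟨α, rfl⟩ := h
    simp only [creationFun, Pi.add_apply]
    rw [(of_mul_injective i).extend_apply, (of_mul_injective i).extend_apply,
      (of_mul_injective i).extend_apply, Pi.add_apply]
  · simp only [creationFun, Pi.add_apply]
    rw [Function.extend_apply' _ _ _ h, Function.extend_apply' _ _ _ h,
      Function.extend_apply' _ _ _ h]
    simp

lemma creationFun_smul [InnerProductSpace ℂ D] (i : ι) (c : ℂ) (f : FreeMonoid ι → D) :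
    creationFun i (c • f) = c • creationFun i f := by
  funext w
  by_cases h : ∃ α, FreeMonoid.of i * α = w
  · obtain ⟨α, rfl⟩ := h
    simp only [creationFun, Pi.smul_apply]
    rw [(of_mul_injective i).extend_apply, (of_mul_injective i).extend_apply, Pi.smul_apply]
  · simp only [creationFun, Pi.smul_apply]
    rw [Function.extend_apply' _ _ _ h, Function.extend_apply' _ _ _ h]
    simp

lemma memℓp_creationFun (i : ι) (f : Fock ι D) :
    Memℓp (creationFun i (f : FreeMonoid ι → D)) 2 := by
  apply memℓp_gen
  rw [norm_rpow_creationFun, summable_extend_zero (of_mul_injective i)]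
  exact (lp.memℓp f).summable (by norm_num)

/-- The operator `Sᵢ ⊗ I_D` on `F²(Hₙ) ⊗ D`, where `Sᵢ` is the `i`-th left creation operator
`f ↦ eᵢ ⊗ f`. It is an isometry. -/
def creation (D : Type v) [NormedAddCommGroup D] [InnerProductSpace ℂ D] (i : ι) :
    Fock ι D →ₗᵢ[ℂ] Fock ι D where
  toFun f := ⟨creationFun i f, memℓp_creationFun i f⟩
  map_add' f g := by
    ext w
    exact congrFun (creationFun_add i f g) w
  map_smul' c f := by
    ext w
    exact congrFun (creationFun_smul i c f) w
  norm_map' f := by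
    have h2 : (0 : ℝ) < (2 : ENNReal).toReal := by norm_num
    rw [lp.norm_eq_tsum_rpow h2, lp.norm_eq_tsum_rpow h2]
    congr 1
    change ∑' w, ‖creationFun i f w‖ ^ (2 : ENNReal).toReal = _
    rw [norm_rpow_creationFun, tsum_extend_zero (of_mul_injective i)]

/-- `(Sᵢ ⊗ I)(e_α ⊗ d) = e_{gᵢ α} ⊗ d`. -/
lemma creation_single [InnerProductSpace ℂ D] [DecidableEq (FreeMonoid ι)] (i : ι) (α : FreeMonoid ι) (d : D) :
    creation D i (lp.single 2 α d) = lp.single 2 (FreeMonoid.of i * α) d := by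
  ext w
  change creationFun i (Pi.single α d) w =
    (Pi.single (FreeMonoid.of i * α) d : FreeMonoid ι → D) w
  unfold creationFun
  by_cases h : ∃ β, FreeMonoid.of i * β = w
  · obtain ⟨β, rfl⟩ := h
    rw [(of_mul_injective i).extend_apply (Pi.single α d) 0 β]
    simp [Pi.single_apply]
  · rw [Function.extend_apply' _ _ _ h, Pi.single_eq_of_ne]
    · rfl
    · rintro rfl
      exact h ⟨α, rfl⟩

end Creation

/-! ### Completely positive maps and their canonical decompositions -/

section Maps

variable {ι : Type u} {H : Type v} [NormedAddCommGroup H] [InnerProductSpace ℂ H] [CompleteSpace H]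

/-- For every bounded `X` the series `∑ᵢ Tᵢ X Tᵢ*` converges, i.e. `X ↦ ∑ᵢ Tᵢ X Tᵢ*` is defined on
all of `B(H)`. Convergence is in the weak operator topology; convergence for `X = I` bounds all
partial sums, and on bounded sets this topology is the w*-topology. -/
def KrausSummable (T : ι → H →L[ℂ] H) : Prop :=
  ∀ X : H →L[ℂ] H, Summable fun i => ContinuousLinearMapWOT.ofCLM (T i * X * adjoint (T i))

/-- The completely positive map `φ_T(X) = ∑ᵢ Tᵢ X Tᵢ*`. -/
def krausMap (T : ι → H →L[ℂ] H) (X : H →L[ℂ] H) : H →L[ℂ] H :=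
  ContinuousLinearMapWOT.toCLM
    (∑' i, ContinuousLinearMapWOT.ofCLM (T i * X * adjoint (T i)))

/-- `A = SOT-lim Xₖ`. -/
def IsSOTLimit (X : ℕ → H →L[ℂ] H) (A : H →L[ℂ] H) : Prop :=
  ∀ h : H, Tendsto (fun k => X k h) atTop (𝓝 (A h))

/-- `C` is a pure solution of `φ(X) ≤ X`: it is a solution and `φᵏ(C) → 0` strongly. -/
def IsPureSolution (φ : (H →L[ℂ] H) → (H →L[ℂ] H)) (C : H →L[ℂ] H) : Prop :=
  φ C ≤ C ∧ IsSOTLimit (fun k => φ^[k] C) 0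

/-- `A = B + C` is a canonical decomposition of `A` with respect to `φ`: `B` is a selfadjoint
solution of `φ(X) = X`, and `C ≥ 0` is a pure solution of `φ(X) ≤ X`. -/
structure IsCanonicalDecomposition (φ : (H →L[ℂ] H) → (H →L[ℂ] H)) (A B C : H →L[ℂ] H) :
    Prop where
  selfAdjoint : IsSelfAdjoint B
  fixed : φ B = B
  nonneg : 0 ≤ C
  pure : IsPureSolution φ C
  sum_eq : A = B + C

end Maps

/-! ### Minimal isometric dilations -/

section Dilation

variable {ι : Type u} {H : Type v} [NormedAddCommGroup H] [InnerProductSpace ℂ H] [CompleteSpace H]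
  {𝒦 : Type w} [NormedAddCommGroup 𝒦] [InnerProductSpace ℂ 𝒦] [CompleteSpace 𝒦]

/-- The compression `P_H Y|_H` of `Y ∈ B(𝒦)` to `H`, where `H` sits in `𝒦` through `J`. -/
def compression (J : H →ₗᵢ[ℂ] 𝒦) (Y : 𝒦 →L[ℂ] 𝒦) : H →L[ℂ] H :=
  adjoint J.toContinuousLinearMap ∘L Y ∘L J.toContinuousLinearMap

/-- `[V₁, V₂, …]` on `𝒦 ⊇ H` is the minimal isometric dilation of `[T₁, T₂, …]`: the `Vᵢ` are
isometries with orthogonal ranges, `Vᵢ*|_H = Tᵢ*`, and `𝒦` is the closed span of all `V_α H`. The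
inclusion of `H` in `𝒦` is the isometry `J`, and `V_α = V_{i₁} ⋯ V_{iₖ}` for `α = g_{i₁} ⋯ g_{iₖ}`. -/
structure IsMinimalIsometricDilation (T : ι → H →L[ℂ] H) (J : H →ₗᵢ[ℂ] 𝒦)
    (V : ι → 𝒦 →L[ℂ] 𝒦) : Prop where
  isometry : ∀ i, adjoint (V i) * V i = 1
  orthogonal : ∀ i j, i ≠ j → adjoint (V i) * V j = 0
  adjoint_apply : ∀ i (h : H), adjoint (V i) (J h) = J (adjoint (T i) h)
  minimal : (Submodule.span ℂ
    {x : 𝒦 | ∃ (α : FreeMonoid ι) (h : H), x = FreeMonoid.lift V α (J h)}).topologicalClosure = ⊤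

/-- `B` is in the commutant of `{Vᵢ, Vᵢ*}`. -/
def InCommutant (V : ι → 𝒦 →L[ℂ] 𝒦) (B : 𝒦 →L[ℂ] 𝒦) : Prop :=
  B ∈ Set.centralizer (Set.range V ∪ Set.range fun i => adjoint (V i))

/-- The data `B`, `Q : 𝒦 → F²(Hₙ) ⊗ D` represent `A`: `B` is in the commutant of `{Vᵢ, Vᵢ*}`,
`A₁ = SOT-lim φ_Vᵏ(B)`, `Vᵢ Q* = Q* (Sᵢ ⊗ I_D)`, `A₂ = Q* Q`,
`A = P_H A₁|_H + P_H A₂|_H`, and `‖A‖ = ‖A₁ + A₂‖`. -/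
structure Represents {D : Type*} [NormedAddCommGroup D] [InnerProductSpace ℂ D] [CompleteSpace D]
    (J : H →ₗᵢ[ℂ] 𝒦) (V : ι → 𝒦 →L[ℂ] 𝒦) (A : H →L[ℂ] H)
    (B : 𝒦 →L[ℂ] 𝒦) (Q : 𝒦 →L[ℂ] Fock ι D) (A₁ A₂ : 𝒦 →L[ℂ] 𝒦) : Prop where
  commutant : InCommutant V B
  limit : IsSOTLimit (fun k => (krausMap V)^[k] B) A₁
  intertwines : ∀ i, V i ∘L adjoint Q = adjoint Q ∘L (creation D i).toContinuousLinearMap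
  eq_adjoint_mul_self : A₂ = adjoint Q ∘L Q
  eq_compression : A = compression J A₁ + compression J A₂
  norm_eq : ‖A‖ = ‖A₁ + A₂‖

end Dilation

end CPMap

end

/-!
Compressing to `H` turns `φ_V` into `φ_T`, because `Vᵢ*|_H = Tᵢ*`. The compression of a fixed point
of `φ_V` is thus a fixed point of `φ_T`, and that of a pure solution is a pure solution. A limit
`A₁` is a fixed point by normality of `φ_V`, and `A₂ = Q*Q` is pure because `φ_V(Q*XQ) = Q*φ_S(X)Q`
and `φ_Sᵏ(I) → 0` for the creation operators `Sᵢ`. So every representation gives a canonical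
decomposition, and that one is unique since its first term must be `SOT-lim φ_Tᵏ(A)`.

Conversely, a solution `A` is lifted to a solution `M` of `φ_V(X) ≤ X` with compression `A` and
`‖M‖ = ‖A‖`. Among the operators `0 ≤ N ≤ ‖A‖` that compress to `A`, every `φ_V(N)` is dominated by
another such operator, as `φ_V(N)` compresses to `φ_T(A) ≤ A`. Choosing `N₀, N₁, …` with
`φ_V(Nₖ) ≤ Nₖ₊₁`, any weak cluster point of the averages `(N₀ + ⋯ + Nₘ) / (m + 1)` can serve as
`M`. Write `M = B + C` canonically. The selfadjoint fixed point `B` commutes with every `Vᵢ`, since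
`φ_V(B) Vᵢ = Vᵢ B`, and the pure part is `C = Q*Q` for the Poisson kernel
`Q h = ∑_α e_α ⊗ Δ V_α* h`, where `Δ = (C - φ_V(C))^{1/2}`.
-/

noncomputable section

namespace CPMap

open scoped ComplexOrder InnerProductSpace

section PositiveOperators

variable {H : Type*} [NormedAddCommGroup H] [InnerProductSpace ℂ H]

lemma inner_self_eq_ofReal_norm_sq (x : H) : ⟪x, x⟫_ℂ = ((‖x‖ ^ 2 : ℝ) : ℂ) := by
  simp [inner_self_eq_norm_sq_to_K]

lemma nonneg_iff_inner {A : H →L[ℂ] H} : 0 ≤ A ↔ ∀ x, 0 ≤ ⟪x, A x⟫_ℂ := by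
  rw [nonneg_iff_isPositive]
  refine ⟨fun hA x => hA.inner_nonneg_right x, fun hA => (isPositive_iff_complex A).2 fun x => ?_⟩
  have hx : 0 ≤ ⟪A x, x⟫_ℂ := by
    rw [← inner_conj_symm]
    exact star_nonneg_iff.2 (hA x)
  exact ⟨(Complex.eq_re_of_ofReal_le hx).symm, (Complex.le_def.1 hx).1⟩

lemma le_iff_inner {A B : H →L[ℂ] H} : A ≤ B ↔ ∀ x, ⟪x, A x⟫_ℂ ≤ ⟪x, B x⟫_ℂ := by
  rw [ContinuousLinearMap.le_def, ← nonneg_iff_isPositive, nonneg_iff_inner]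
  simp only [sub_apply, inner_sub_right, sub_nonneg]

lemma re_inner_nonneg {A : H →L[ℂ] H} (hA : 0 ≤ A) (x : H) : 0 ≤ (⟪x, A x⟫_ℂ).re :=
  (Complex.le_def.1 (nonneg_iff_inner.1 hA x)).1

lemma re_inner_mono {A B : H →L[ℂ] H} (hAB : A ≤ B) (x : H) :
    (⟪x, A x⟫_ℂ).re ≤ (⟪x, B x⟫_ℂ).re :=
  (Complex.le_def.1 (le_iff_inner.1 hAB x)).1

lemma eq_of_inner_self_eq {A B : H →L[ℂ] H} (h : ∀ x, ⟪x, A x⟫_ℂ = ⟪x, B x⟫_ℂ) : A = B :=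
  le_antisymm (le_iff_inner.2 fun x => (h x).le) (le_iff_inner.2 fun x => (h x).ge)

lemma norm_le_of_nonneg_of_le_smul_one [CompleteSpace H] {A : H →L[ℂ] H} {c : ℝ} (hc : 0 ≤ c)
    (h0 : 0 ≤ A) (hA : A ≤ c • (1 : H →L[ℂ] H)) : ‖A‖ ≤ c := by
  refine (CStarAlgebra.norm_le_norm_of_nonneg_of_le h0 hA).trans ?_
  rw [norm_smul, Real.norm_of_nonneg hc]
  exact mul_le_of_le_one_right hc norm_id_le

lemma le_norm_smul_one [CompleteSpace H] {A : H →L[ℂ] H} (hA : IsSelfAdjoint A) :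
    A ≤ ‖A‖ • (1 : H →L[ℂ] H) := by
  rw [← Algebra.algebraMap_eq_smul_one]
  exact hA.le_algebraMap_norm_self

variable [CompleteSpace H] {K : Type*} [NormedAddCommGroup K] [InnerProductSpace ℂ K]
  [CompleteSpace K]

lemma adjoint_conj_mono (W : H →L[ℂ] K) {X Y : K →L[ℂ] K} (h : X ≤ Y) :
    adjoint W ∘L X ∘L W ≤ adjoint W ∘L Y ∘L W := by
  rw [le_iff_inner] at h ⊢
  simpa only [comp_apply, adjoint_inner_right] using fun x => h (W x)

lemma adjoint_sqrt (P : H →L[ℂ] H) : adjoint (CFC.sqrt P) = CFC.sqrt P :=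
  (CFC.sqrt_nonneg P).isSelfAdjoint.adjoint_eq

lemma norm_sq_sqrt_apply {P : H →L[ℂ] H} (hP : 0 ≤ P) (x : H) :
    ((‖CFC.sqrt P x‖ ^ 2 : ℝ) : ℂ) = ⟪x, P x⟫_ℂ := by
  rw [← inner_self_eq_ofReal_norm_sq, ← adjoint_inner_right, adjoint_sqrt, ← mul_apply_eq_comp,
    CFC.sqrt_mul_sqrt_self P hP]

lemma norm_sq_apply_le {P : H →L[ℂ] H} (hP : 0 ≤ P) (x : H) :
    ‖P x‖ ^ 2 ≤ ‖P‖ * (⟪x, P x⟫_ℂ).re := by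
  set s := CFC.sqrt P
  have hs : s * s = P := CFC.sqrt_mul_sqrt_self P hP
  have hnorm : ‖P‖ = ‖s‖ ^ 2 := by
    rw [← hs, sq, (CFC.sqrt_nonneg P).isSelfAdjoint.norm_mul_self, sq]
  calc ‖P x‖ ^ 2 = ‖s (s x)‖ ^ 2 := by rw [← mul_apply_eq_comp, hs]
    _ ≤ (‖s‖ * ‖s x‖) ^ 2 := by gcongr; exact le_opNorm s _
    _ = ‖P‖ * (⟪x, P x⟫_ℂ).re := by
      rw [mul_pow, hnorm, ← norm_sq_sqrt_apply hP, Complex.ofReal_re]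

end PositiveOperators

section StrongLimits

variable {H : Type*} [NormedAddCommGroup H] [InnerProductSpace ℂ H]
  {X : ℕ → H →L[ℂ] H} {L M : H →L[ℂ] H}

lemma IsSOTLimit.unique (hL : IsSOTLimit X L) (hM : IsSOTLimit X M) : L = M :=
  ContinuousLinearMap.ext fun x => tendsto_nhds_unique (hL x) (hM x)

lemma IsSOTLimit.nonneg (hL : IsSOTLimit X L) (hX : ∀ k, 0 ≤ X k) : 0 ≤ L :=
  nonneg_iff_inner.2 fun x =>
    ge_of_tendsto' (tendsto_const_nhds.inner (hL x)) fun k => nonneg_iff_inner.1 (hX k) x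

lemma IsSOTLimit.le (hL : IsSOTLimit X L) (hX : ∀ k, X k ≤ M) : L ≤ M :=
  le_iff_inner.2 fun x =>
    le_of_tendsto' (tendsto_const_nhds.inner (hL x)) fun k => le_iff_inner.1 (hX k) x

lemma IsSOTLimit.const_mul (hL : IsSOTLimit X L) (B : H →L[ℂ] H) :
    IsSOTLimit (fun k => B * X k) (B * L) :=
  fun x => (B.continuous.tendsto _).comp (hL x)

variable [CompleteSpace H]

lemma IsSOTLimit.adjoint_conj {K : Type*} [NormedAddCommGroup K] [InnerProductSpace ℂ K]
    [CompleteSpace K] (hL : IsSOTLimit X L) (W : K →L[ℂ] H) :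
    IsSOTLimit (fun k => adjoint W ∘L X k ∘L W) (adjoint W ∘L L ∘L W) :=
  fun x => ((adjoint W).continuous.tendsto _).comp (hL (W x))

lemma norm_sq_sub_apply_le_of_antitone (hX : Antitone X) (h0 : ∀ k, 0 ≤ X k) {k l : ℕ}
    (hkl : k ≤ l) (x : H) :
    ‖X k x - X l x‖ ^ 2 ≤ ‖X 0‖ * ((⟪x, X k x⟫_ℂ).re - (⟪x, X l x⟫_ℂ).re) := by
  have hsub : 0 ≤ X k - X l := sub_nonneg.2 (hX hkl)
  have hnorm : ‖X k - X l‖ ≤ ‖X 0‖ := CStarAlgebra.norm_le_norm_of_nonneg_of_le hsub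
    ((sub_le_self _ (h0 l)).trans (hX k.zero_le))
  calc ‖X k x - X l x‖ ^ 2 = ‖(X k - X l) x‖ ^ 2 := rfl
    _ ≤ ‖X k - X l‖ * (⟪x, (X k - X l) x⟫_ℂ).re := norm_sq_apply_le hsub x
    _ ≤ ‖X 0‖ * (⟪x, (X k - X l) x⟫_ℂ).re := by
      gcongr
      exact re_inner_nonneg hsub x
    _ = ‖X 0‖ * ((⟪x, X k x⟫_ℂ).re - (⟪x, X l x⟫_ℂ).re) := by
      rw [sub_apply, inner_sub_right, Complex.sub_re]

lemma exists_isSOTLimit_of_antitone (hX : Antitone X) (h0 : ∀ k, 0 ≤ X k) :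
    ∃ L : H →L[ℂ] H, IsSOTLimit X L := by
  have hlim (x : H) : ∃ y, Tendsto (fun k => X k x) atTop (𝓝 y) := by
    let r : ℕ → ℝ := fun k => (⟪x, X k x⟫_ℂ).re
    have hr : Antitone r := fun k l hkl => re_inner_mono (hX hkl) x
    have hbdd : BddBelow (Set.range r) :=
      ⟨0, Set.forall_mem_range.2 fun k => re_inner_nonneg (h0 k) x⟩
    have hbound : Tendsto (fun k => √(‖X 0‖ * (r k - ⨅ n, r n))) atTop (𝓝 0) := by
      simpa only [sub_self, mul_zero, Real.sqrt_zero] using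
        (((tendsto_atTop_ciInf hr hbdd).sub_const (⨅ n, r n)).const_mul ‖X 0‖).sqrt
    refine cauchySeq_tendsto_of_complete (cauchySeq_of_le_tendsto_0' _ (fun k l hkl => ?_) hbound)
    rw [dist_eq_norm]
    refine Real.le_sqrt_of_sq_le ((norm_sq_sub_apply_le_of_antitone hX h0 hkl x).trans ?_)
    gcongr
    exact ciInf_le hbdd l
  choose y hy using hlim
  exact ⟨continuousLinearMapOfTendsto X (tendsto_pi_nhds.2 hy), hy⟩

end StrongLimits

section WeakLimits

variable {𝕜 E F α : Type*} [RCLike 𝕜] [SeminormedAddCommGroup E] [NormedSpace 𝕜 E]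
  [NormedAddCommGroup F] [InnerProductSpace 𝕜 F] [CompleteSpace F]

lemma exists_tendsto_ultrafilter_of_norm_le {G : Type*} [SeminormedAddCommGroup G] [ProperSpace G]
    (𝒰 : Ultrafilter α) {f : α → G} {C : ℝ} (hf : ∀ a, ‖f a‖ ≤ C) :
    ∃ c, Tendsto f 𝒰 (𝓝 c) := by
  obtain ⟨c, -, hc⟩ := (isCompact_closedBall (0 : G) C).ultrafilter_le_nhds' (𝒰.map f)
    (mem_map.2 (univ_mem' fun a => by simpa using hf a))
  exact ⟨c, hc⟩

lemma exists_weakLimit_ultrafilter (𝒰 : Ultrafilter α) {X : α → E →L[𝕜] F} {C : ℝ}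
    (hX : ∀ a, ‖X a‖ ≤ C) :
    ∃ L : E →L[𝕜] F, ∀ x y, Tendsto (fun a => inner 𝕜 x (X a y)) 𝒰 (𝓝 (inner 𝕜 x (L y))) := by
  have hbound (a : α) (y : E) (x : F) : ‖inner 𝕜 (X a y) x‖ ≤ C * ‖y‖ * ‖x‖ :=
    (norm_inner_le_norm _ _).trans (by gcongr; exact (X a).le_of_opNorm_le (hX a) y)
  choose b hb using fun y x => exists_tendsto_ultrafilter_of_norm_le 𝒰 (hbound · y x)
  let B : E →L⋆[𝕜] F →L[𝕜] 𝕜 := LinearMap.mkContinuous₂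
    (LinearMap.mk₂'ₛₗ (starRingEnd 𝕜) (RingHom.id 𝕜) b
      (fun y y' x => tendsto_nhds_unique (hb _ _)
        (((hb y x).add (hb y' x)).congr fun a => by rw [map_add, inner_add_left]))
      (fun c y x => tendsto_nhds_unique (hb _ _)
        (((hb y x).const_mul _).congr fun a => by rw [map_smul, inner_smul_left]))
      (fun y x x' => tendsto_nhds_unique (hb _ _)
        (((hb y x).add (hb y x')).congr fun a => (inner_add_right _ _ _).symm))
      (fun c y x => tendsto_nhds_unique (hb _ _)
        (((hb y x).const_mul _).congr fun a => (inner_smul_right _ _ _).symm)))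
    C fun y x => le_of_tendsto' (hb y x).norm (hbound · y x)
  refine ⟨(InnerProductSpace.toDual 𝕜 F).symm.toContinuousLinearEquiv.toContinuousLinearMap ∘SL B,
    fun x y => ?_⟩
  have hL : inner 𝕜 ((InnerProductSpace.toDual 𝕜 F).symm (B y)) x = b y x :=
    InnerProductSpace.toDual_symm_apply
  have hconj := (RCLike.continuous_conj (K := 𝕜)).tendsto _ |>.comp (hb y x)
  rw [← hL, inner_conj_symm] at hconj
  exact hconj.congr fun a => inner_conj_symm _ _

end WeakLimits

section Interpolation

lemma exists_norm_le_one_comp_eq {𝕜 E F K : Type*} [RCLike 𝕜]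
    [NormedAddCommGroup E] [NormedSpace 𝕜 E] [NormedAddCommGroup F] [NormedSpace 𝕜 F]
    [CompleteSpace F] [NormedAddCommGroup K] [InnerProductSpace 𝕜 K] [CompleteSpace K]
    {R : E →L[𝕜] K} {S : E →L[𝕜] F} (h : ∀ x, ‖S x‖ ≤ ‖R x‖) :
    ∃ G : K →L[𝕜] F, ‖G‖ ≤ 1 ∧ G ∘L R = S := by
  let U : Submodule 𝕜 K := R.range.topologicalClosure
  let e : E →ₗ[𝕜] U := R.toLinearMap.codRestrict U
    fun x => R.range.le_topologicalClosure (LinearMap.mem_range_self _ x)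
  have he : DenseRange e := by
    refine Subtype.dense_iff.2 fun y hy => closure_mono ?_ hy
    rintro _ ⟨x, rfl⟩
    exact ⟨e x, Set.mem_range_self x, rfl⟩
  have hSe : ∀ x, ‖S.toLinearMap x‖ ≤ 1 * ‖e x‖ := fun x => (h x).trans_eq (one_mul _).symm
  refine ⟨S.toLinearMap.extendOfNorm e ∘L U.orthogonalProjectionOnto, ?_, ?_⟩
  · refine opNorm_le_bound _ zero_le_one fun y => ?_
    refine (LinearMap.norm_extendOfNorm_apply_le he 1 hSe _).trans ?_
    gcongr
    exact U.norm_orthogonalProjectionOnto_apply_le y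
  · ext x
    have hproj : U.orthogonalProjectionOnto (R x) = e x :=
      U.orthogonalProjectionOnto_mem_subspace_eq_self (e x)
    rw [comp_apply, comp_apply, hproj, LinearMap.extendOfNorm_eq he ⟨1, hSe⟩, coe_coe]

variable {H : Type*} [NormedAddCommGroup H] [InnerProductSpace ℂ H] [CompleteSpace H]
  {K : Type*} [NormedAddCommGroup K] [InnerProductSpace ℂ K] [CompleteSpace K]
  {W : H →L[ℂ] K}

lemma exists_adjoint_conj_eq_of_le {Y : H →L[ℂ] H} {Z : K →L[ℂ] K} (hZ : 0 ≤ Z) (hY : 0 ≤ Y)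
    (hYZ : Y ≤ adjoint W ∘L Z ∘L W) :
    ∃ N : K →L[ℂ] K, 0 ≤ N ∧ N ≤ Z ∧ adjoint W ∘L N ∘L W = Y := by
  have hle (x : H) : ‖CFC.sqrt Y x‖ ≤ ‖(CFC.sqrt Z ∘L W) x‖ := by
    have hx := le_iff_inner.1 hYZ x
    rw [comp_apply, comp_apply, adjoint_inner_right, ← norm_sq_sqrt_apply hY,
      ← norm_sq_sqrt_apply hZ, Complex.real_le_real] at hx
    exact le_of_sq_le_sq hx (norm_nonneg _)
  obtain ⟨G, hG, hGW⟩ := exists_norm_le_one_comp_eq hle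
  let R : K →L[ℂ] H := G ∘L CFC.sqrt Z
  have hR (x : K) : ⟪x, (adjoint R ∘L R) x⟫_ℂ = ((‖R x‖ ^ 2 : ℝ) : ℂ) := by
    rw [comp_apply, adjoint_inner_right, inner_self_eq_ofReal_norm_sq]
  refine ⟨adjoint R ∘L R, ?_, le_iff_inner.2 fun x => ?_, eq_of_inner_self_eq fun x => ?_⟩
  · exact (nonneg_iff_isPositive _).2 (isPositive_adjoint_comp_self R)
  · rw [hR, ← norm_sq_sqrt_apply hZ, Complex.real_le_real]
    gcongr
    exact G.le_of_opNorm_le hG _ |>.trans_eq (one_mul _)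
  · have hRW : R (W x) = CFC.sqrt Y x := congrArg (· x) hGW
    rw [comp_apply, comp_apply, adjoint_inner_right, hR, hRW, norm_sq_sqrt_apply hY]

lemma exists_adjoint_conj_eq {L Z : K →L[ℂ] K} {A : H →L[ℂ] H} (hLZ : L ≤ Z)
    (hL : adjoint W ∘L L ∘L W ≤ A) (hZ : A ≤ adjoint W ∘L Z ∘L W) :
    ∃ N : K →L[ℂ] K, L ≤ N ∧ N ≤ Z ∧ adjoint W ∘L N ∘L W = A := by
  have hdiff : A - adjoint W ∘L L ∘L W ≤ adjoint W ∘L (Z - L) ∘L W := by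
    rw [sub_comp, comp_sub]
    exact sub_le_sub_right hZ _
  obtain ⟨N, hN0, hNZ, hN⟩ :=
    exists_adjoint_conj_eq_of_le (sub_nonneg.2 hLZ) (sub_nonneg.2 hL) hdiff
  refine ⟨L + N, le_add_of_nonneg_right hN0, le_sub_iff_add_le'.1 hNZ, ?_⟩
  rw [add_comp, comp_add, hN, add_sub_cancel]

end Interpolation

section KrausMaps

variable {ι : Type*} {H : Type*} [NormedAddCommGroup H] [InnerProductSpace ℂ H] [CompleteSpace H]
  {T : ι → H →L[ℂ] H}

lemma hasSum_ofCLM_iff {X : ι → H →L[ℂ] H} {L : H →L[ℂ] H} :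
    HasSum (fun i => ContinuousLinearMapWOT.ofCLM (X i)) (ContinuousLinearMapWOT.ofCLM L) ↔
      ∀ x y, HasSum (fun i => ⟪x, X i y⟫_ℂ) ⟪x, L y⟫_ℂ := by
  have hsum (F : Finset ι) : ∑ i ∈ F, ContinuousLinearMapWOT.ofCLM (X i) =
      ContinuousLinearMapWOT.ofCLM (∑ i ∈ F, X i) :=
    (map_sum (ContinuousLinearMapWOT.addEquiv (σ := RingHom.id ℂ) (E := H) (F := H)).symm _ F).symm
  rw [HasSum, ContinuousLinearMapWOT.tendsto_iff_forall_inner_apply_tendsto, forall_comm]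
  simp only [HasSum, hsum, ContinuousLinearMapWOT.ofCLM_apply, sum_apply, inner_sum]

lemma krausSummable_iff : KrausSummable T ↔ ∀ X : H →L[ℂ] H, ∃ L : H →L[ℂ] H,
    ∀ x y, HasSum (fun i => ⟪adjoint (T i) x, X (adjoint (T i) y)⟫_ℂ) ⟪x, L y⟫_ℂ := by
  refine forall_congr' fun X => ?_
  have hiff (L : H →L[ℂ] H) := hasSum_ofCLM_iff (X := fun i => T i * X * adjoint (T i)) (L := L)
  simp only [adjoint_inner_left]
  exact ⟨fun ⟨L, hL⟩ => ⟨L.toCLM, (hiff L.toCLM).1 hL⟩, fun ⟨L, hL⟩ => ⟨_, (hiff L).2 hL⟩⟩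

lemma hasSum_inner_krausMap (hT : KrausSummable T) (X : H →L[ℂ] H) (x y : H) :
    HasSum (fun i => ⟪adjoint (T i) x, X (adjoint (T i) y)⟫_ℂ) ⟪x, krausMap T X y⟫_ℂ := by
  simp only [adjoint_inner_left]
  exact hasSum_ofCLM_iff.1 (hT X).hasSum x y

lemma krausMap_eq (hT : KrausSummable T) {X Y : H →L[ℂ] H}
    (h : ∀ x y, HasSum (fun i => ⟪adjoint (T i) x, X (adjoint (T i) y)⟫_ℂ) ⟪x, Y y⟫_ℂ) :
    krausMap T X = Y := by
  ext y
  exact ext_inner_left ℂ fun x => (hasSum_inner_krausMap hT X x y).unique (h x y)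

lemma isLinearMap_krausMap (hT : KrausSummable T) : IsLinearMap ℂ (krausMap T) where
  map_add X Y := krausMap_eq hT fun x y => by
    simpa only [add_apply, inner_add_right] using
      (hasSum_inner_krausMap hT X x y).add (hasSum_inner_krausMap hT Y x y)
  map_smul c X := krausMap_eq hT fun x y => by
    simpa only [smul_apply, inner_smul_right] using (hasSum_inner_krausMap hT X x y).mul_left c

lemma krausMap_real_smul (hT : KrausSummable T) (c : ℝ) (X : H →L[ℂ] H) :
    krausMap T (c • X) = c • krausMap T X :=
  (IsLinearMap.mk' _ (isLinearMap_krausMap hT)).map_smul_of_tower c X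

lemma krausMap_iterate_add (hT : KrausSummable T) (k : ℕ) (X Y : H →L[ℂ] H) :
    (krausMap T)^[k] (X + Y) = (krausMap T)^[k] X + (krausMap T)^[k] Y :=
  iterate_map_add (IsLinearMap.mk' _ (isLinearMap_krausMap hT)) k X Y

lemma krausMap_iterate_sub (hT : KrausSummable T) (k : ℕ) (X Y : H →L[ℂ] H) :
    (krausMap T)^[k] (X - Y) = (krausMap T)^[k] X - (krausMap T)^[k] Y :=
  iterate_map_sub (IsLinearMap.mk' _ (isLinearMap_krausMap hT)) k X Y

lemma krausMap_mono (hT : KrausSummable T) : Monotone (krausMap T) := fun X Y hXY =>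
  le_iff_inner.2 fun x => hasSum_le (fun _ => le_iff_inner.1 hXY _)
    (hasSum_inner_krausMap hT X x x) (hasSum_inner_krausMap hT Y x x)

lemma krausMap_nonneg (hT : KrausSummable T) {X : H →L[ℂ] H} (hX : 0 ≤ X) : 0 ≤ krausMap T X :=
  (isLinearMap_krausMap hT).map_zero ▸ krausMap_mono hT hX

lemma krausMap_iterate_nonneg (hT : KrausSummable T) {X : H →L[ℂ] H} (hX : 0 ≤ X) (k : ℕ) :
    0 ≤ (krausMap T)^[k] X :=
  Function.Iterate.rec (0 ≤ ·) hX (fun _ => krausMap_nonneg hT) k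

lemma antitone_krausMap_iterate (hT : KrausSummable T) {X : H →L[ℂ] H} (hX : krausMap T X ≤ X) :
    Antitone fun k => (krausMap T)^[k] X :=
  (krausMap_mono hT).antitone_iterate_of_map_le hX

lemma summable_norm_sq_adjoint (hT : KrausSummable T) (x : H) :
    Summable fun i => ‖adjoint (T i) x‖ ^ 2 := by
  have hsum := (hasSum_inner_krausMap hT 1 x x).summable
  simp only [one_apply_eq_self, inner_self_eq_ofReal_norm_sq] at hsum
  exact Complex.summable_ofReal.1 hsum

lemma tendsto_inner_krausMap (hT : KrausSummable T) {X : ℕ → H →L[ℂ] H} {L : H →L[ℂ] H}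
    (hX : IsSOTLimit X L) (x y : H) :
    Tendsto (fun n => ⟪x, krausMap T (X n) y⟫_ℂ) atTop (𝓝 ⟪x, krausMap T L y⟫_ℂ) := by
  obtain ⟨C, hC⟩ : ∃ C, ∀ n, ‖X n‖ ≤ C :=
    banach_steinhaus fun z => (hX z).norm.bddAbove_range.imp fun C hC n => hC ⟨n, rfl⟩
  have hC0 : 0 ≤ C := (norm_nonneg _).trans (hC 0)
  simp only [← (hasSum_inner_krausMap hT _ x y).tsum_eq]
  refine tendsto_tsum_of_dominated_convergence
    (bound := fun i => C * (‖adjoint (T i) x‖ ^ 2 + ‖adjoint (T i) y‖ ^ 2))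
    (((summable_norm_sq_adjoint hT x).add (summable_norm_sq_adjoint hT y)).mul_left C)
    (fun i => tendsto_const_nhds.inner (hX _)) (Eventually.of_forall fun n i => ?_)
  set a := adjoint (T i) x
  set b := adjoint (T i) y
  calc ‖⟪a, X n b⟫_ℂ‖ ≤ ‖a‖ * ‖X n b‖ := norm_inner_le_norm _ _
    _ ≤ ‖a‖ * (C * ‖b‖) := by gcongr; exact (X n).le_of_opNorm_le (hC n) b
    _ = C * (‖a‖ * ‖b‖) := by ring
    _ ≤ C * (‖a‖ ^ 2 + ‖b‖ ^ 2) := by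
      gcongr
      nlinarith [two_mul_le_add_sq ‖a‖ ‖b‖, norm_nonneg a, norm_nonneg b]

lemma krausMap_eq_self_of_isSOTLimit (hT : KrausSummable T) {X L : H →L[ℂ] H}
    (hL : IsSOTLimit (fun k => (krausMap T)^[k] X) L) : krausMap T L = L := by
  ext y
  refine ext_inner_left ℂ fun x => tendsto_nhds_unique (tendsto_inner_krausMap hT hL x y) ?_
  simp only [← Function.iterate_succ_apply' (krausMap T)]
  exact tendsto_const_nhds.inner ((hL y).comp (tendsto_add_atTop_nat 1))

end KrausMaps

section Intertwining

variable {ι : Type*} {H : Type*} [NormedAddCommGroup H] [InnerProductSpace ℂ H] [CompleteSpace H]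
  {K : Type*} [NormedAddCommGroup K] [InnerProductSpace ℂ K] [CompleteSpace K]
  {T : ι → H →L[ℂ] H} {V : ι → K →L[ℂ] K} {W : H →L[ℂ] K}

lemma hasSum_inner_adjoint_conj (hV : KrausSummable V)
    (hW : ∀ i x, adjoint (V i) (W x) = W (adjoint (T i) x)) (Y : K →L[ℂ] K) (x y : H) :
    HasSum (fun i => ⟪adjoint (T i) x, (adjoint W ∘L Y ∘L W) (adjoint (T i) y)⟫_ℂ)
      ⟪x, (adjoint W ∘L krausMap V Y ∘L W) y⟫_ℂ := by
  simpa only [comp_apply, adjoint_inner_right W, ← hW] using hasSum_inner_krausMap hV Y (W x) (W y)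

lemma krausSummable_of_adjoint_comp_self_eq_one (hV : KrausSummable V)
    (hW : ∀ i x, adjoint (V i) (W x) = W (adjoint (T i) x)) (hW1 : adjoint W ∘L W = 1) :
    KrausSummable T := by
  refine krausSummable_iff.2 fun X =>
    ⟨adjoint W ∘L krausMap V (W ∘L X ∘L adjoint W) ∘L W, ?_⟩
  have hX : adjoint W ∘L (W ∘L X ∘L adjoint W) ∘L W = X := by
    rw [comp_assoc, comp_assoc, hW1, ← comp_assoc, hW1]
    exact (one_mul _).trans (mul_one X)
  simpa only [hX] using hasSum_inner_adjoint_conj hV hW (W ∘L X ∘L adjoint W)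

lemma krausMap_adjoint_conj (hT : KrausSummable T) (hV : KrausSummable V)
    (hW : ∀ i x, adjoint (V i) (W x) = W (adjoint (T i) x)) (Y : K →L[ℂ] K) :
    krausMap T (adjoint W ∘L Y ∘L W) = adjoint W ∘L krausMap V Y ∘L W :=
  krausMap_eq hT (hasSum_inner_adjoint_conj hV hW Y)

lemma krausMap_iterate_adjoint_conj (hT : KrausSummable T) (hV : KrausSummable V)
    (hW : ∀ i x, adjoint (V i) (W x) = W (adjoint (T i) x)) (k : ℕ) (Y : K →L[ℂ] K) :
    (krausMap T)^[k] (adjoint W ∘L Y ∘L W) = adjoint W ∘L (krausMap V)^[k] Y ∘L W :=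
  (Function.Semiconj.iterate_right (f := fun Y => adjoint W ∘L Y ∘L W)
    (fun Y => (krausMap_adjoint_conj hT hV hW Y).symm) k Y).symm

lemma IsPureSolution.adjoint_conj (hT : KrausSummable T) (hV : KrausSummable V)
    (hW : ∀ i x, adjoint (V i) (W x) = W (adjoint (T i) x)) {C : K →L[ℂ] K}
    (hC : IsPureSolution (krausMap V) C) :
    IsPureSolution (krausMap T) (adjoint W ∘L C ∘L W) := by
  refine ⟨(krausMap_adjoint_conj hT hV hW C).trans_le (adjoint_conj_mono W hC.1), ?_⟩
  simpa only [krausMap_iterate_adjoint_conj hT hV hW, zero_comp, comp_zero] using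
    hC.2.adjoint_conj W

end Intertwining

section CanonicalDecomposition

variable {ι : Type*} {H : Type*} [NormedAddCommGroup H] [InnerProductSpace ℂ H] [CompleteSpace H]
  {T : ι → H →L[ℂ] H} {A B C B' C' : H →L[ℂ] H}

namespace IsCanonicalDecomposition

lemma isSOTLimit (hT : KrausSummable T) (h : IsCanonicalDecomposition (krausMap T) A B C) :
    IsSOTLimit (fun k => (krausMap T)^[k] A) B := by
  intro x
  simp only [h.sum_eq, krausMap_iterate_add hT, Function.iterate_fixed h.fixed, add_apply]
  simpa using (h.pure.2 x).const_add (B x)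

lemma unique (hT : KrausSummable T) (h : IsCanonicalDecomposition (krausMap T) A B C)
    (h' : IsCanonicalDecomposition (krausMap T) A B' C') : B = B' ∧ C = C' := by
  obtain rfl : B = B' := (h.isSOTLimit hT).unique (h'.isSOTLimit hT)
  exact ⟨rfl, add_left_cancel (h.sum_eq.symm.trans h'.sum_eq)⟩

lemma krausMap_le (hT : KrausSummable T) (h : IsCanonicalDecomposition (krausMap T) A B C) :
    krausMap T A ≤ A := by
  rw [h.sum_eq, (isLinearMap_krausMap hT).map_add, h.fixed]
  exact add_le_add_right h.pure.1 B

end IsCanonicalDecomposition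

lemma exists_isCanonicalDecomposition (hT : KrausSummable T) (hA : 0 ≤ A)
    (hTA : krausMap T A ≤ A) : ∃ B C, IsCanonicalDecomposition (krausMap T) A B C := by
  have hanti := antitone_krausMap_iterate hT hTA
  have hnonneg := krausMap_iterate_nonneg hT hA
  obtain ⟨B, hB⟩ := exists_isSOTLimit_of_antitone hanti hnonneg
  have hfixed : krausMap T B = B := krausMap_eq_self_of_isSOTLimit hT hB
  refine ⟨B, A - B, (hB.nonneg hnonneg).isSelfAdjoint, hfixed,
    sub_nonneg.2 (hB.le fun k => hanti k.zero_le), ⟨?_, fun x => ?_⟩, (add_sub_cancel B A).symm⟩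
  · rw [(isLinearMap_krausMap hT).map_sub, hfixed]
    exact sub_le_sub_right hTA B
  · simp only [krausMap_iterate_sub hT, Function.iterate_fixed hfixed]
    simpa using (hB x).sub_const (B x)

end CanonicalDecomposition

section RowIsometries

variable {ι : Type*} {K : Type*} [NormedAddCommGroup K] [InnerProductSpace ℂ K] [CompleteSpace K]
  {V : ι → K →L[ℂ] K}

/-- `[V₁, V₂, …]` is a row isometry: the `Vᵢ` are isometries with pairwise orthogonal ranges, i.e.
the row operator `(kᵢ) ↦ ∑ᵢ Vᵢ kᵢ` on the direct sum of copies of `K` is an isometry. -/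
structure IsRowIsometry (V : ι → K →L[ℂ] K) : Prop where
  isometry : ∀ i, adjoint (V i) * V i = 1
  orthogonal : ∀ i j, i ≠ j → adjoint (V i) * V j = 0

namespace IsRowIsometry

lemma adjoint_apply_self (hV : IsRowIsometry V) (i : ι) (x : K) : adjoint (V i) (V i x) = x :=
  congrArg (· x) (hV.isometry i)

lemma adjoint_apply_of_ne (hV : IsRowIsometry V) {i j : ι} (hij : i ≠ j) (x : K) :
    adjoint (V i) (V j x) = 0 :=
  congrArg (· x) (hV.orthogonal i j hij)

lemma norm_apply (hV : IsRowIsometry V) (i : ι) (x : K) : ‖V i x‖ = ‖x‖ :=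
  (V i).norm_map_iff_adjoint_comp_self.2 (hV.isometry i) x

lemma orthogonalFamily (hV : IsRowIsometry V) : OrthogonalFamily ℂ (fun _ : ι => K)
    fun i => { toLinearMap := (V i).toLinearMap, norm_map' := hV.norm_apply i } := by
  intro i j hij x y
  change ⟪V i x, V j y⟫_ℂ = 0
  rw [← adjoint_inner_right, hV.adjoint_apply_of_ne hij, inner_zero_right]

lemma norm_sum_sq (hV : IsRowIsometry V) (F : Finset ι) (y : ι → K) :
    ‖∑ i ∈ F, V i (y i)‖ ^ 2 = ∑ i ∈ F, ‖y i‖ ^ 2 :=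
  hV.orthogonalFamily.norm_sum y F

lemma sum_norm_sq_adjoint_le (hV : IsRowIsometry V) (F : Finset ι) (x : K) :
    ∑ i ∈ F, ‖adjoint (V i) x‖ ^ 2 ≤ ‖x‖ ^ 2 := by
  set p := ∑ i ∈ F, V i (adjoint (V i) x) with hp
  have hnorm : ‖p‖ ^ 2 = ∑ i ∈ F, ‖adjoint (V i) x‖ ^ 2 := hV.norm_sum_sq F _
  have hinner : ⟪x, p⟫_ℂ = ((‖p‖ ^ 2 : ℝ) : ℂ) := by
    rw [hnorm, hp, inner_sum, Complex.ofReal_sum]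
    exact Finset.sum_congr rfl fun i _ => by
      rw [← adjoint_inner_left, inner_self_eq_ofReal_norm_sq]
  have hle : ‖p‖ ^ 2 ≤ ‖x‖ * ‖p‖ := by
    simpa only [hinner, Complex.norm_real, norm_pow, norm_norm] using
      norm_inner_le_norm (𝕜 := ℂ) x p
  rw [← hnorm]
  nlinarith [sq_nonneg (‖x‖ - ‖p‖)]

lemma sum_norm_sq_apply_adjoint_le (hV : IsRowIsometry V) (X : K →L[ℂ] K) (F : Finset ι) (x : K) :
    ∑ i ∈ F, ‖X (adjoint (V i) x)‖ ^ 2 ≤ (‖X‖ * ‖x‖) ^ 2 :=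
  calc ∑ i ∈ F, ‖X (adjoint (V i) x)‖ ^ 2 ≤ ∑ i ∈ F, ‖X‖ ^ 2 * ‖adjoint (V i) x‖ ^ 2 := by
        gcongr with i
        rw [← mul_pow]
        gcongr
        exact le_opNorm X _
    _ ≤ (‖X‖ * ‖x‖) ^ 2 := by
      rw [← Finset.mul_sum, mul_pow]
      gcongr
      exact hV.sum_norm_sq_adjoint_le F x

lemma summable_apply_adjoint (hV : IsRowIsometry V) (X : K →L[ℂ] K) (x : K) :
    Summable fun i => V i (X (adjoint (V i) x)) :=
  (hV.orthogonalFamily.summable_iff_norm_sq_summable fun i => X (adjoint (V i) x)).2 <|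
    summable_of_sum_le (fun _ => sq_nonneg _) (hV.sum_norm_sq_apply_adjoint_le X · x)

lemma krausSummable (hV : IsRowIsometry V) : KrausSummable V := by
  refine krausSummable_iff.2 fun X => ?_
  let S : Finset ι → K →L[ℂ] K := fun F => ∑ i ∈ F, V i ∘L X ∘L adjoint (V i)
  have hS (F : Finset ι) (x : K) : S F x = ∑ i ∈ F, V i (X (adjoint (V i) x)) := by
    simp only [S, sum_apply, comp_apply]
  have hlim (x : K) : Tendsto (fun F => S F x) atTop (𝓝 (∑' i, V i (X (adjoint (V i) x)))) :=
    (hV.summable_apply_adjoint X x).hasSum.congr fun F => (hS F x).symm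
  have hbound (F : Finset ι) : ‖S F‖ ≤ ‖X‖ := opNorm_le_bound _ (norm_nonneg X) fun x => by
    refine le_of_sq_le_sq ?_ (by positivity)
    rw [hS, hV.norm_sum_sq F fun i => X (adjoint (V i) x)]
    exact hV.sum_norm_sq_apply_adjoint_le X F x
  let L : K →L[ℂ] K := ofTendstoOfBoundedRange _ S (tendsto_pi_nhds.2 hlim)
    (isBounded_iff_forall_norm_le.2 ⟨‖X‖, Set.forall_mem_range.2 hbound⟩)
  refine ⟨L, fun x y => (tendsto_const_nhds.inner (hlim y)).congr fun F => ?_⟩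
  simp only [hS, inner_sum, adjoint_inner_left]

lemma adjoint_apply_krausMap (hV : IsRowIsometry V) (X : K →L[ℂ] K) (j : ι) (y : K) :
    adjoint (V j) (krausMap V X y) = X (adjoint (V j) y) := by
  refine ext_inner_left ℂ fun x => ?_
  rw [adjoint_inner_right]
  refine (hasSum_inner_krausMap hV.krausSummable X _ y).unique ?_
  simpa only [hV.adjoint_apply_self] using
    hasSum_single (f := fun i => ⟪adjoint (V i) (V j x), X (adjoint (V i) y)⟫_ℂ) j
      fun i hij => by rw [hV.adjoint_apply_of_ne hij, inner_zero_left]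

lemma krausMap_one_le (hV : IsRowIsometry V) : krausMap V 1 ≤ 1 := by
  refine le_iff_inner.2 fun x =>
    hasSum_le_of_sum_le (hasSum_inner_krausMap hV.krausSummable 1 x x) fun F => ?_
  simp only [one_apply_eq_self, inner_self_eq_ofReal_norm_sq]
  exact_mod_cast hV.sum_norm_sq_adjoint_le F x

lemma inCommutant_of_krausMap_eq_self (hV : IsRowIsometry V) {X : K →L[ℂ] K}
    (hX : IsSelfAdjoint X) (hfix : krausMap V X = X) : InCommutant V X := by
  have hcomm (j : ι) : adjoint (V j) * X = X * adjoint (V j) := by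
    ext x
    simpa only [hfix, mul_apply_eq_comp] using hV.adjoint_apply_krausMap X j x
  refine Set.mem_centralizer_iff.2 ?_
  rintro _ (⟨j, rfl⟩ | ⟨j, rfl⟩)
  · simpa only [star_mul, hX.star_eq, ← star_eq_adjoint, star_star] using
      (congrArg star (hcomm j)).symm
  · exact hcomm j

end IsRowIsometry

lemma krausMap_mul_of_inCommutant (hV : KrausSummable V) {B : K →L[ℂ] K} (hB : InCommutant V B)
    (Y : K →L[ℂ] K) : krausMap V (B * Y) = B * krausMap V Y := by
  have hBV (i : ι) (x : K) : adjoint (V i) (adjoint B x) = adjoint B (adjoint (V i) x) := by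
    have hcomm := congrArg star (hB (V i) (Or.inl ⟨i, rfl⟩))
    rw [star_mul, star_mul] at hcomm
    exact (congrArg (· x) hcomm).symm
  refine krausMap_eq hV fun x y => ?_
  simpa only [mul_apply_eq_comp, hBV, adjoint_inner_left B] using
    hasSum_inner_krausMap hV Y (adjoint B x) y

lemma krausMap_iterate_of_inCommutant (hV : KrausSummable V) {B : K →L[ℂ] K}
    (hB : InCommutant V B) (k : ℕ) : (krausMap V)^[k] B = B * (krausMap V)^[k] 1 := by
  induction k with
  | zero => exact (mul_one B).symm
  | succ k ih =>
    rw [Function.iterate_succ_apply', ih, krausMap_mul_of_inCommutant hV hB,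
      Function.iterate_succ_apply']

lemma exists_isSOTLimit_krausMap_iterate (hV : KrausSummable V) (hV1 : krausMap V 1 ≤ 1)
    {B : K →L[ℂ] K} (hB : InCommutant V B) :
    ∃ A₁ : K →L[ℂ] K, IsSOTLimit (fun k => (krausMap V)^[k] B) A₁ := by
  obtain ⟨P, hP⟩ := exists_isSOTLimit_of_antitone (antitone_krausMap_iterate hV hV1)
    (krausMap_iterate_nonneg hV zero_le_one)
  refine ⟨B * P, ?_⟩
  simpa only [krausMap_iterate_of_inCommutant hV hB] using hP.const_mul B

end RowIsometries

section FockSpace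

variable {ι : Type*} {D : Type*} [NormedAddCommGroup D] [InnerProductSpace ℂ D]

lemma creation_apply_of_forall_ne (i : ι) (f : Fock ι D) {α : FreeMonoid ι}
    (h : ∀ β, FreeMonoid.of i * β ≠ α) : creation D i f α = 0 :=
  Function.extend_apply' _ _ _ fun ⟨β, hβ⟩ => h β hβ

lemma inner_creation_of_ne {i j : ι} (hij : i ≠ j) (f g : Fock ι D) :
    ⟪creation D i f, creation D j g⟫_ℂ = 0 := by
  rw [lp.inner_eq_tsum]
  refine (tsum_congr fun α => ?_).trans tsum_zero
  by_cases h : ∃ β, FreeMonoid.of i * β = α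
  · obtain ⟨β, rfl⟩ := h
    have hne (γ : FreeMonoid ι) : FreeMonoid.of j * γ ≠ FreeMonoid.of i * β :=
      fun hγ => hij (List.cons.inj hγ).1.symm
    rw [creation_apply_of_forall_ne j g hne, inner_zero_right]
  · rw [creation_apply_of_forall_ne i f (not_exists.1 h), inner_zero_left]

lemma inner_single [DecidableEq (FreeMonoid ι)] (α : FreeMonoid ι) (d : D) (f : Fock ι D) :
    ⟪(lp.single 2 α d : Fock ι D), f⟫_ℂ = ⟪d, f α⟫_ℂ :=
  lp.inner_single_left α d f

variable [CompleteSpace D]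

lemma isRowIsometry_creation :
    IsRowIsometry fun i : ι => (creation D i).toContinuousLinearMap where
  isometry i := (norm_map_iff_adjoint_comp_self _).1 (creation D i).norm_map
  orthogonal i j hij := by
    ext1 f
    refine ext_inner_left ℂ fun g => ?_
    rw [mul_apply_eq_comp, adjoint_inner_right, zero_apply, inner_zero_right]
    exact inner_creation_of_ne hij g f

lemma adjoint_creation_apply (i : ι) (f : Fock ι D) (α : FreeMonoid ι) :
    adjoint (creation D i).toContinuousLinearMap f α = f (FreeMonoid.of i * α) := by
  classical
  refine ext_inner_left ℂ fun d => (inner_single α d _).symm.trans ?_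
  rw [adjoint_inner_right]
  change ⟪creation D i (lp.single 2 α d), f⟫_ℂ = _
  rw [creation_single, inner_single]

lemma adjoint_creation_single_one [DecidableEq (FreeMonoid ι)] (i : ι) (d : D) :
    adjoint (creation D i).toContinuousLinearMap (lp.single 2 1 d) = 0 := by
  ext α
  rw [adjoint_creation_apply, lp.single_apply, Pi.single_eq_of_ne]
  · rfl
  · exact List.cons_ne_nil i α

lemma krausMap_creation_apply_one (X : Fock ι D →L[ℂ] Fock ι D) (f : Fock ι D) :
    krausMap (fun i : ι => (creation D i).toContinuousLinearMap) X f 1 = 0 := by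
  classical
  refine ext_inner_left ℂ fun d => (inner_single 1 d _).symm.trans ?_
  rw [inner_zero_right]
  refine (hasSum_inner_krausMap isRowIsometry_creation.krausSummable X _ f).unique ?_
  simpa only [adjoint_creation_single_one, inner_zero_left] using hasSum_zero

lemma eq_zero_of_krausMap_creation_eq_self {X : Fock ι D →L[ℂ] Fock ι D}
    (hX : krausMap (fun i : ι => (creation D i).toContinuousLinearMap) X = X) : X = 0 := by
  ext f α
  change X f α = 0
  induction α using FreeMonoid.recOn generalizing f with
  | one => rw [← hX, krausMap_creation_apply_one]
  | of_mul i α ih =>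
    rw [← adjoint_creation_apply, ← hX, isRowIsometry_creation.adjoint_apply_krausMap]
    exact ih _

lemma isPureSolution_creation_one :
    IsPureSolution (krausMap fun i : ι => (creation D i).toContinuousLinearMap) 1 := by
  have hS := isRowIsometry_creation (ι := ι) (D := D)
  refine ⟨hS.krausMap_one_le, ?_⟩
  obtain ⟨R, hR⟩ := exists_isSOTLimit_of_antitone
    (antitone_krausMap_iterate hS.krausSummable hS.krausMap_one_le)
    (krausMap_iterate_nonneg hS.krausSummable zero_le_one)
  obtain rfl := eq_zero_of_krausMap_creation_eq_self
    (krausMap_eq_self_of_isSOTLimit hS.krausSummable hR)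
  exact hR

variable {K : Type*} [NormedAddCommGroup K] [InnerProductSpace ℂ K] [CompleteSpace K]
  {V : ι → K →L[ℂ] K}

lemma intertwines_adjoint_iff {Q : K →L[ℂ] Fock ι D} (i : ι) :
    V i ∘L adjoint Q = adjoint Q ∘L (creation D i).toContinuousLinearMap ↔
      ∀ x, adjoint (creation D i).toContinuousLinearMap (Q x) = Q (adjoint (V i) x) := by
  rw [← adjoint.injective.eq_iff, adjoint_comp, adjoint_comp, adjoint_adjoint, eq_comm,
    ContinuousLinearMap.ext_iff]
  rfl

lemma isPureSolution_adjoint_comp_self (hV : KrausSummable V) {Q : K →L[ℂ] Fock ι D}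
    (hQ : ∀ i, V i ∘L adjoint Q = adjoint Q ∘L (creation D i).toContinuousLinearMap) :
    IsPureSolution (krausMap V) (adjoint Q ∘L Q) :=
  isPureSolution_creation_one.adjoint_conj hV isRowIsometry_creation.krausSummable
    fun i => (intertwines_adjoint_iff i).1 (hQ i)

end FockSpace

section PoissonKernel

lemma tsum_freeMonoid {ι : Type*} (f : FreeMonoid ι → ENNReal) :
    ∑' α, f α = f 1 + ∑' i, ∑' α, f (FreeMonoid.of i * α) := by
  classical
  have hinj : Function.Injective fun p : ι × FreeMonoid ι => FreeMonoid.of p.1 * p.2 :=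
    fun _ _ h => Prod.ext (List.cons.inj h).1 (List.cons.inj h).2
  rw [ENNReal.tsum_eq_add_tsum_ite 1, ← hinj.tsum_eq, ENNReal.tsum_prod']
  · exact congrArg (f 1 + ·) (tsum_congr fun i => tsum_congr fun α =>
      if_neg (List.cons_ne_nil i α))
  · intro α hα
    induction α using FreeMonoid.casesOn with
    | one => exact absurd (if_pos rfl) hα
    | of_mul i α => exact ⟨(i, α), rfl⟩

lemma tsum_eq_iSup_tsum_length_lt {ι : Type*} (f : FreeMonoid ι → ENNReal) :
    ∑' α, f α = ⨆ k : ℕ, ∑' α, if α.length < k then f α else 0 := by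
  refine le_antisymm ?_ (iSup_le fun k => ENNReal.tsum_le_tsum fun α => ?_)
  · rw [ENNReal.tsum_eq_iSup_sum]
    refine iSup_le fun F => ?_
    obtain ⟨k, hk⟩ : ∃ k, ∀ α ∈ F, α.length < k :=
      ⟨F.sup FreeMonoid.length + 1, fun α hα => Nat.lt_succ_of_le (Finset.le_sup hα)⟩
    calc ∑ α ∈ F, f α = ∑ α ∈ F, if α.length < k then f α else 0 :=
          Finset.sum_congr rfl fun α hα => (if_pos (hk α hα)).symm
      _ ≤ ∑' α, if α.length < k then f α else 0 := ENNReal.sum_le_tsum F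
      _ ≤ _ := le_iSup (fun k => ∑' α : FreeMonoid ι, if α.length < k then f α else 0) k
  · split_ifs
    · exact le_rfl
    · exact zero_le

lemma exists_lp_apply_eq {𝕜 β E D : Type*} [RCLike 𝕜] [SeminormedAddCommGroup E] [NormedSpace 𝕜 E]
    [NormedAddCommGroup D] [NormedSpace 𝕜 D] {R : β → E →L[𝕜] D} {c : ℝ} (hc : 0 ≤ c)
    (hR : ∀ x F, ∑ b ∈ F, ‖R b x‖ ^ 2 ≤ (c * ‖x‖) ^ 2) :
    ∃ Q : E →L[𝕜] lp (fun _ : β => D) 2, ∀ x b, Q x b = R b x := by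
  have h2 : ((2 : ENNReal).toReal) = ((2 : ℕ) : ℝ) := by norm_num
  let Q : E →ₗ[𝕜] lp (fun _ : β => D) 2 :=
    { toFun x := ⟨fun b => R b x, memℓp_gen' (C := (c * ‖x‖) ^ 2) fun F => by
        simpa only [h2, Real.rpow_natCast] using hR x F⟩
      map_add' x y := by ext b; exact map_add (R b) x y
      map_smul' a x := by ext b; exact map_smul (R b) a x }
  refine ⟨Q.mkContinuous c fun x => lp.norm_le_of_forall_sum_le (by norm_num) (by positivity)
    fun F => ?_, fun x b => rfl⟩
  simp only [h2, Real.rpow_natCast]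
  exact hR x F

variable {ι : Type*} {K : Type*} [NormedAddCommGroup K] [InnerProductSpace ℂ K] [CompleteSpace K]
  {V : ι → K →L[ℂ] K} {C : K →L[ℂ] K}

/-- The coordinate at the word `α` of the Poisson kernel `x ↦ ∑ e_α ⊗ Δ V_α* x` of a solution `C`
of `φ_V(X) ≤ X`, where `Δ = (C - φ_V(C))^{1/2}`. -/
def poissonCoeff (V : ι → K →L[ℂ] K) (C : K →L[ℂ] K) (α : FreeMonoid ι) : K →L[ℂ] K :=
  CFC.sqrt (C - krausMap V C) ∘L adjoint (FreeMonoid.lift V α)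

lemma poissonCoeff_one : poissonCoeff V C 1 = CFC.sqrt (C - krausMap V C) := by
  rw [poissonCoeff, map_one, ← star_eq_adjoint, star_one]
  exact mul_one _

lemma poissonCoeff_of_mul_apply (i : ι) (α : FreeMonoid ι) (x : K) :
    poissonCoeff V C (FreeMonoid.of i * α) x = poissonCoeff V C α (adjoint (V i) x) := by
  rw [poissonCoeff, map_mul, FreeMonoid.lift_eval_of, ← star_eq_adjoint, star_mul]
  rfl

lemma norm_sq_sqrt_defect_add (hV : KrausSummable V) (hC : krausMap V C ≤ C) (k : ℕ) (x : K) :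
    ‖CFC.sqrt (C - krausMap V C) x‖ ^ 2 + (⟪x, krausMap V (C - (krausMap V)^[k] C) x⟫_ℂ).re =
      (⟪x, (C - (krausMap V)^[k + 1] C) x⟫_ℂ).re := by
  have hsqrt := congrArg Complex.re (norm_sq_sqrt_apply (sub_nonneg.2 hC) x)
  rw [Complex.ofReal_re] at hsqrt
  rw [hsqrt, (isLinearMap_krausMap hV).map_sub, ← Function.iterate_succ_apply' (krausMap V),
    ← Complex.add_re, ← inner_add_right, ← add_apply, sub_add_sub_cancel]

lemma tsum_norm_sq_poissonCoeff_length_lt (hV : KrausSummable V) (hC : krausMap V C ≤ C) (k : ℕ)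
    (x : K) : ∑' α : FreeMonoid ι, (if α.length < k then
        ENNReal.ofReal (‖poissonCoeff V C α x‖ ^ 2) else 0) =
      ENNReal.ofReal (⟪x, (C - (krausMap V)^[k] C) x⟫_ℂ).re := by
  induction k generalizing x with
  | zero => simp
  | succ k ih =>
    have hnonneg (y : K) : 0 ≤ (⟪y, (C - (krausMap V)^[k] C) y⟫_ℂ).re :=
      re_inner_nonneg (sub_nonneg.2 (antitone_krausMap_iterate hV hC k.zero_le)) y
    have hsum := Complex.hasSum_re (hasSum_inner_krausMap hV (C - (krausMap V)^[k] C) x x)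
    rw [tsum_freeMonoid, FreeMonoid.length_one, if_pos k.succ_pos]
    simp only [FreeMonoid.length_mul, FreeMonoid.length_of, Nat.add_comm 1,
      Nat.add_lt_add_iff_right, poissonCoeff_of_mul_apply, ih]
    rw [poissonCoeff_one, ← ENNReal.ofReal_tsum_of_nonneg (fun _ => hnonneg _) hsum.summable,
      hsum.tsum_eq, ← ENNReal.ofReal_add (sq_nonneg _) (hsum.nonneg fun _ => hnonneg _),
      norm_sq_sqrt_defect_add hV hC]

lemma tsum_norm_sq_poissonCoeff (hV : KrausSummable V) (hC : IsPureSolution (krausMap V) C)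
    (x : K) : ∑' α, ENNReal.ofReal (‖poissonCoeff V C α x‖ ^ 2) =
      ENNReal.ofReal (⟪x, C x⟫_ℂ).re := by
  rw [tsum_eq_iSup_tsum_length_lt]
  simp only [tsum_norm_sq_poissonCoeff_length_lt hV hC.1]
  have hmono : Monotone fun k => ENNReal.ofReal (⟪x, (C - (krausMap V)^[k] C) x⟫_ℂ).re :=
    fun k l hkl => ENNReal.ofReal_le_ofReal <|
      re_inner_mono (sub_le_sub_left (antitone_krausMap_iterate hV hC.1 hkl) C) x
  have hlim : Tendsto (fun k => (C - (krausMap V)^[k] C) x) atTop (𝓝 (C x)) := by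
    simpa using (hC.2 x).const_sub (C x)
  exact tendsto_nhds_unique (tendsto_atTop_iSup hmono) <|
    ENNReal.tendsto_ofReal ((Complex.continuous_re.tendsto _).comp (tendsto_const_nhds.inner hlim))

lemma hasSum_norm_sq_poissonCoeff (hV : KrausSummable V) (h0 : 0 ≤ C)
    (hC : IsPureSolution (krausMap V) C) (x : K) :
    HasSum (fun α => ‖poissonCoeff V C α x‖ ^ 2) (⟪x, C x⟫_ℂ).re := by
  have htsum := tsum_norm_sq_poissonCoeff hV hC x
  have hsum := ENNReal.hasSum_toReal (htsum ▸ ENNReal.ofReal_ne_top)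
  rw [← ENNReal.tsum_toReal_eq fun _ => ENNReal.ofReal_ne_top, htsum,
    ENNReal.toReal_ofReal (re_inner_nonneg h0 x)] at hsum
  simpa only [ENNReal.toReal_ofReal (sq_nonneg _)] using hsum

lemma exists_poissonKernel (hV : KrausSummable V) (h0 : 0 ≤ C)
    (hC : IsPureSolution (krausMap V) C) :
    ∃ Q : K →L[ℂ] Fock ι K, ∀ x α, Q x α = poissonCoeff V C α x := by
  refine exists_lp_apply_eq (c := ‖CFC.sqrt C‖) (norm_nonneg _) fun x F => ?_
  have hsqrt := congrArg Complex.re (norm_sq_sqrt_apply h0 x)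
  calc ∑ α ∈ F, ‖poissonCoeff V C α x‖ ^ 2 ≤ (⟪x, C x⟫_ℂ).re :=
        sum_le_hasSum F (fun _ _ => sq_nonneg _) (hasSum_norm_sq_poissonCoeff hV h0 hC x)
    _ = ‖CFC.sqrt C x‖ ^ 2 := hsqrt.symm
    _ ≤ (‖CFC.sqrt C‖ * ‖x‖) ^ 2 := by
      gcongr
      exact le_opNorm _ x

lemma exists_intertwining_factorization (hV : KrausSummable V) (h0 : 0 ≤ C)
    (hC : IsPureSolution (krausMap V) C) :
    ∃ Q : K →L[ℂ] Fock ι K,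
      (∀ i, V i ∘L adjoint Q = adjoint Q ∘L (creation K i).toContinuousLinearMap) ∧
      C = adjoint Q ∘L Q := by
  obtain ⟨Q, hQ⟩ := exists_poissonKernel hV h0 hC
  refine ⟨Q, fun i => (intertwines_adjoint_iff i).2 fun x => ?_, eq_of_inner_self_eq fun x => ?_⟩
  · ext α
    rw [adjoint_creation_apply, hQ, hQ, poissonCoeff_of_mul_apply]
  · have hnorm : ‖Q x‖ ^ 2 = ∑' α, ‖Q x α‖ ^ 2 := by
      simpa using lp.norm_rpow_eq_tsum (p := 2) (by norm_num) (Q x)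
    simp only [hQ, (hasSum_norm_sq_poissonCoeff hV h0 hC x).tsum_eq] at hnorm
    rw [comp_apply, adjoint_inner_right, inner_self_eq_ofReal_norm_sq, hnorm]
    exact Complex.eq_re_of_ofReal_le (nonneg_iff_inner.1 h0 x)

end PoissonKernel

section Compressions

variable {H : Type*} [NormedAddCommGroup H] [InnerProductSpace ℂ H] [CompleteSpace H]
  {K : Type*} [NormedAddCommGroup K] [InnerProductSpace ℂ K] [CompleteSpace K] {J : H →ₗᵢ[ℂ] K}

lemma inner_compression (Y : K →L[ℂ] K) (x : H) : ⟪x, compression J Y x⟫_ℂ = ⟪J x, Y (J x)⟫_ℂ := by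
  rw [compression, comp_apply, comp_apply, adjoint_inner_right]
  rfl

lemma adjoint_comp_self (J : H →ₗᵢ[ℂ] K) :
    adjoint J.toContinuousLinearMap ∘L J.toContinuousLinearMap = 1 :=
  (norm_map_iff_adjoint_comp_self _).1 J.norm_map

lemma isLinearMap_compression (J : H →ₗᵢ[ℂ] K) : IsLinearMap ℝ (compression J) where
  map_add X Y := by simp only [compression, add_comp, comp_add]
  map_smul c X := by simp only [compression, smul_comp, comp_smul]

lemma compression_one : compression J (1 : K →L[ℂ] K) = 1 :=
  adjoint_comp_self J

lemma norm_compression_le (J : H →ₗᵢ[ℂ] K) (Y : K →L[ℂ] K) : ‖compression J Y‖ ≤ ‖Y‖ := by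
  have hJ : ‖J.toContinuousLinearMap‖ ≤ 1 := J.norm_toContinuousLinearMap_le
  calc ‖compression J Y‖ ≤ ‖adjoint J.toContinuousLinearMap‖ * (‖Y‖ * ‖J.toContinuousLinearMap‖) :=
        (opNorm_comp_le _ _).trans (by gcongr; exact opNorm_comp_le _ _)
    _ ≤ 1 * (‖Y‖ * 1) := by
        gcongr
        rwa [LinearIsometryEquiv.norm_map]
    _ = ‖Y‖ := by rw [one_mul, mul_one]

variable {A : H →L[ℂ] H}

/-- The positive liftings of `A` to an operator on `K` which do not exceed `‖A‖`. -/
def positiveLifts (J : H →ₗᵢ[ℂ] K) (A : H →L[ℂ] H) : Set (K →L[ℂ] K) :=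
  Set.Icc 0 (‖A‖ • 1) ∩ compression J ⁻¹' {A}

lemma norm_eq_of_mem_positiveLifts {N : K →L[ℂ] K} (hN : N ∈ positiveLifts J A) : ‖N‖ = ‖A‖ :=
  le_antisymm (norm_le_of_nonneg_of_le_smul_one (norm_nonneg A) hN.1.1 hN.1.2)
    (hN.2 ▸ norm_compression_le J N)

lemma convex_positiveLifts (J : H →ₗᵢ[ℂ] K) (A : H →L[ℂ] H) : Convex ℝ (positiveLifts J A) :=
  (convex_Icc 0 (‖A‖ • 1)).inter ((convex_singleton A).is_linear_preimage
    (isLinearMap_compression J))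

lemma mem_positiveLifts_of_tendsto {α : Type*} {l : Filter α} [l.NeBot] {E : α → K →L[ℂ] K}
    {M : K →L[ℂ] K} (hE : ∀ a, E a ∈ positiveLifts J A)
    (hM : ∀ x, Tendsto (fun a => ⟪x, E a x⟫_ℂ) l (𝓝 ⟪x, M x⟫_ℂ)) : M ∈ positiveLifts J A := by
  refine ⟨⟨nonneg_iff_inner.2 fun x => ?_, le_iff_inner.2 fun x => ?_⟩,
    eq_of_inner_self_eq fun x => ?_⟩
  · exact ge_of_tendsto' (hM x) fun a => nonneg_iff_inner.1 (hE a).1.1 x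
  · exact le_of_tendsto' (hM x) fun a => le_iff_inner.1 (hE a).1.2 x
  · rw [inner_compression]
    refine tendsto_nhds_unique (hM (J x)) (tendsto_const_nhds.congr fun a => ?_)
    rw [← inner_compression, (hE a).2]

lemma exists_ge_mem_positiveLifts (hA : IsSelfAdjoint A) {L : K →L[ℂ] K} (h0 : 0 ≤ L)
    (h1 : L ≤ ‖A‖ • (1 : K →L[ℂ] K)) (hL : compression J L ≤ A) :
    ∃ N ∈ positiveLifts J A, L ≤ N := by
  have hA1 : A ≤ compression J (‖A‖ • (1 : K →L[ℂ] K)) := by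
    rw [(isLinearMap_compression J).map_smul, compression_one]
    exact le_norm_smul_one hA
  obtain ⟨N, hLN, hN1, hN⟩ := exists_adjoint_conj_eq h1 hL hA1
  exact ⟨N, ⟨⟨h0.trans hLN, hN1⟩, hN⟩, hLN⟩

end Compressions

section Averages

lemma average_mem_of_convex {E : Type*} [AddCommGroup E] [Module ℝ E] {S : Set E} (hS : Convex ℝ S)
    {N : ℕ → E} (hN : ∀ k, N k ∈ S) (m : ℕ) :
    (m + 1 : ℝ)⁻¹ • ∑ k ∈ Finset.range (m + 1), N k ∈ S := by
  rw [Finset.smul_sum]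
  refine hS.sum_mem (fun _ _ => by positivity) ?_ fun k _ => hN k
  rw [Finset.sum_const, Finset.card_range, nsmul_eq_mul, Nat.cast_add_one,
    mul_inv_cancel₀ (by positivity)]

variable {ι : Type*} {K : Type*} [NormedAddCommGroup K] [InnerProductSpace ℂ K] [CompleteSpace K]
  {V : ι → K →L[ℂ] K}

lemma krausMap_average_le (hV : KrausSummable V) {N : ℕ → K →L[ℂ] K} {Z : K →L[ℂ] K}
    (h0 : 0 ≤ N 0) (hZ : ∀ k, N k ≤ Z) (hN : ∀ k, krausMap V (N k) ≤ N (k + 1)) (m : ℕ) :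
    krausMap V ((m + 1 : ℝ)⁻¹ • ∑ k ∈ Finset.range (m + 1), N k) ≤
      (m + 1 : ℝ)⁻¹ • ∑ k ∈ Finset.range (m + 1), N k + (m + 1 : ℝ)⁻¹ • Z := by
  rw [krausMap_real_smul hV, ← smul_add]
  refine smul_le_smul_of_nonneg_left ?_ (by positivity)
  calc krausMap V (∑ k ∈ Finset.range (m + 1), N k)
      = ∑ k ∈ Finset.range (m + 1), krausMap V (N k) :=
        map_sum (IsLinearMap.mk' _ (isLinearMap_krausMap hV)) N _
    _ ≤ ∑ k ∈ Finset.range (m + 1), N (k + 1) := Finset.sum_le_sum fun k _ => hN k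
    _ ≤ ∑ k ∈ Finset.range (m + 1), N (k + 1) + N 0 := le_add_of_nonneg_right h0
    _ = ∑ k ∈ Finset.range (m + 1), N k + N (m + 1) := by
      rw [← Finset.sum_range_succ', Finset.sum_range_succ]
    _ ≤ ∑ k ∈ Finset.range (m + 1), N k + Z := by
      gcongr
      exact hZ _

lemma krausMap_le_of_tendsto (hV : KrausSummable V) {α : Type*} {l : Filter α} [l.NeBot]
    {E : α → K →L[ℂ] K} {M Z : K →L[ℂ] K} {c : α → ℝ}
    (hM : ∀ x, Tendsto (fun a => ⟪x, E a x⟫_ℂ) l (𝓝 ⟪x, M x⟫_ℂ)) (hc : Tendsto c l (𝓝 0))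
    (h0 : ∀ a, 0 ≤ E a) (hE : ∀ a, krausMap V (E a) ≤ E a + c a • Z) : krausMap V M ≤ M := by
  refine le_iff_inner.2 fun x =>
    hasSum_le_of_sum_le (hasSum_inner_krausMap hV M x x) fun F => ?_
  have hlim : Tendsto (fun a => ⟪x, (E a + c a • Z) x⟫_ℂ) l (𝓝 ⟪x, M x⟫_ℂ) := by
    simpa only [add_apply, smul_apply, inner_add_right, inner_smul_right_eq_smul, zero_smul,
      add_zero] using (hM x).add (hc.smul_const ⟪x, Z x⟫_ℂ)
  refine le_of_tendsto_of_tendsto' (tendsto_finsetSum F fun i _ => hM (adjoint (V i) x)) hlim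
    fun a => ?_
  calc ∑ i ∈ F, ⟪adjoint (V i) x, E a (adjoint (V i) x)⟫_ℂ ≤ ⟪x, krausMap V (E a) x⟫_ℂ :=
        sum_le_hasSum F (fun i _ => nonneg_iff_inner.1 (h0 a) _) (hasSum_inner_krausMap hV _ x x)
    _ ≤ ⟪x, (E a + c a • Z) x⟫_ℂ := le_iff_inner.1 (hE a) x

end Averages

section IsometricDilations

variable {ι : Type*} {H : Type*} [NormedAddCommGroup H] [InnerProductSpace ℂ H] [CompleteSpace H]
  {K : Type*} [NormedAddCommGroup K] [InnerProductSpace ℂ K] [CompleteSpace K]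
  {T : ι → H →L[ℂ] H} {V : ι → K →L[ℂ] K} {J : H →ₗᵢ[ℂ] K}

/-- `[V₁, V₂, …]` on `K ⊇ H` is an isometric dilation, not necessarily minimal, of
`[T₁, T₂, …]`: a row isometry with `Vᵢ*|_H = Tᵢ*`, where `H` sits in `K` through `J`. -/
structure IsIsometricDilation (T : ι → H →L[ℂ] H) (J : H →ₗᵢ[ℂ] K) (V : ι → K →L[ℂ] K) :
    Prop where
  isRowIsometry : IsRowIsometry V
  adjoint_apply : ∀ i (h : H), adjoint (V i) (J h) = J (adjoint (T i) h)

lemma IsMinimalIsometricDilation.isIsometricDilation (hV : IsMinimalIsometricDilation T J V) :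
    IsIsometricDilation T J V :=
  ⟨⟨hV.isometry, hV.orthogonal⟩, hV.adjoint_apply⟩

namespace IsIsometricDilation

lemma krausSummable (hV : IsIsometricDilation T J V) : KrausSummable T :=
  krausSummable_of_adjoint_comp_self_eq_one (W := J.toContinuousLinearMap)
    hV.isRowIsometry.krausSummable (fun i h => hV.adjoint_apply i h) (adjoint_comp_self J)

lemma krausMap_compression (hV : IsIsometricDilation T J V) (Y : K →L[ℂ] K) :
    krausMap T (compression J Y) = compression J (krausMap V Y) :=
  krausMap_adjoint_conj (W := J.toContinuousLinearMap) hV.krausSummable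
    hV.isRowIsometry.krausSummable (fun i h => hV.adjoint_apply i h) Y

lemma exists_krausMap_le_mem_positiveLifts (hV : IsIsometricDilation T J V) {A : H →L[ℂ] H}
    (hA : IsSelfAdjoint A) (hTA : krausMap T A ≤ A) {N : K →L[ℂ] K}
    (hN : N ∈ positiveLifts J A) : ∃ N' ∈ positiveLifts J A, krausMap V N ≤ N' := by
  have hVS := hV.isRowIsometry.krausSummable
  refine exists_ge_mem_positiveLifts hA (krausMap_nonneg hVS hN.1.1) ?_ ?_
  · calc krausMap V N ≤ krausMap V (‖A‖ • 1) := krausMap_mono hVS hN.1.2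
      _ = ‖A‖ • krausMap V 1 := krausMap_real_smul hVS _ _
      _ ≤ ‖A‖ • 1 :=
        smul_le_smul_of_nonneg_left hV.isRowIsometry.krausMap_one_le (norm_nonneg A)
  · rwa [← hV.krausMap_compression, hN.2]

lemma exists_seq_mem_positiveLifts (hV : IsIsometricDilation T J V) {A : H →L[ℂ] H}
    (hA : 0 ≤ A) (hTA : krausMap T A ≤ A) :
    ∃ N : ℕ → K →L[ℂ] K, (∀ k, N k ∈ positiveLifts J A) ∧ ∀ k, krausMap V (N k) ≤ N (k + 1) := by
  obtain ⟨N₀, hN₀, -⟩ := exists_ge_mem_positiveLifts (J := J) hA.isSelfAdjoint le_rfl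
    (smul_nonneg (norm_nonneg A) zero_le_one)
    (((isLinearMap_compression J).map_zero).trans_le hA)
  choose g hg hle using fun N : positiveLifts J A =>
    hV.exists_krausMap_le_mem_positiveLifts hA.isSelfAdjoint hTA N.2
  let N : ℕ → positiveLifts J A := fun k => (fun N => ⟨g N, hg N⟩)^[k] ⟨N₀, hN₀⟩
  refine ⟨fun k => N k, fun k => (N k).2, fun k => ?_⟩
  simp only [N, Function.iterate_succ_apply']
  exact hle _

lemma exists_krausMap_le_self_mem_positiveLifts (hV : IsIsometricDilation T J V)
    {A : H →L[ℂ] H} (hA : 0 ≤ A) (hTA : krausMap T A ≤ A) :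
    ∃ M ∈ positiveLifts J A, krausMap V M ≤ M := by
  have hVS := hV.isRowIsometry.krausSummable
  obtain ⟨N, hN, hle⟩ := hV.exists_seq_mem_positiveLifts hA hTA
  let E : ℕ → K →L[ℂ] K := fun m => (m + 1 : ℝ)⁻¹ • ∑ k ∈ Finset.range (m + 1), N k
  have hE (m : ℕ) : E m ∈ positiveLifts J A :=
    average_mem_of_convex (convex_positiveLifts J A) hN m
  obtain ⟨M, hM⟩ := exists_weakLimit_ultrafilter (hyperfilter ℕ)
    fun m => (norm_eq_of_mem_positiveLifts (hE m)).le
  have hc : Tendsto (fun m : ℕ => (m + 1 : ℝ)⁻¹) (hyperfilter ℕ : Filter ℕ) (𝓝 0) := by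
    simpa only [one_div] using
      (tendsto_one_div_add_atTop_nhds_zero_nat (𝕜 := ℝ)).mono_left Nat.hyperfilter_le_atTop
  have hVE (m : ℕ) : krausMap V (E m) ≤ E m + (m + 1 : ℝ)⁻¹ • ‖A‖ • (1 : K →L[ℂ] K) :=
    krausMap_average_le hVS (hN 0).1.1 (fun k => (hN k).1.2) hle m
  exact ⟨M, mem_positiveLifts_of_tendsto hE fun x => hM x x,
    krausMap_le_of_tendsto hVS (fun x => hM x x) hc (fun m => (hE m).1.1) hVE⟩

end IsIsometricDilation

end IsometricDilations

section Representations

variable {ι : Type*} {H : Type*} [NormedAddCommGroup H] [InnerProductSpace ℂ H] [CompleteSpace H]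
  {K : Type*} [NormedAddCommGroup K] [InnerProductSpace ℂ K] [CompleteSpace K]
  {T : ι → H →L[ℂ] H} {V : ι → K →L[ℂ] K} {J : H →ₗᵢ[ℂ] K} {A : H →L[ℂ] H}

lemma IsIsometricDilation.exists_represents (hV : IsIsometricDilation T J V) (hA : 0 ≤ A)
    (hTA : krausMap T A ≤ A) :
    ∃ (B : K →L[ℂ] K) (Q : K →L[ℂ] Fock ι K) (A₁ A₂ : K →L[ℂ] K), Represents J V A B Q A₁ A₂ := by
  have hVS := hV.isRowIsometry.krausSummable
  obtain ⟨M, hM, hVM⟩ := hV.exists_krausMap_le_self_mem_positiveLifts hA hTA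
  obtain ⟨B, C, hBC⟩ := exists_isCanonicalDecomposition hVS hM.1.1 hVM
  obtain ⟨Q, hQ, hCQ⟩ := exists_intertwining_factorization hVS hBC.nonneg hBC.pure
  refine ⟨B, Q, B, C, ?_, fun x => ?_, hQ, hCQ, ?_, ?_⟩
  · exact hV.isRowIsometry.inCommutant_of_krausMap_eq_self hBC.selfAdjoint hBC.fixed
  · simpa only [Function.iterate_fixed hBC.fixed] using tendsto_const_nhds
  · rw [← (isLinearMap_compression J).map_add, ← hBC.sum_eq, hM.2]
  · rw [← hBC.sum_eq, norm_eq_of_mem_positiveLifts hM]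

lemma Represents.isCanonicalDecomposition {D : Type*} [NormedAddCommGroup D]
    [InnerProductSpace ℂ D] [CompleteSpace D] (hV : IsIsometricDilation T J V)
    (hA : IsSelfAdjoint A) {B A₁ A₂ : K →L[ℂ] K} {Q : K →L[ℂ] Fock ι D}
    (h : Represents J V A B Q A₁ A₂) :
    IsCanonicalDecomposition (krausMap T) A (compression J A₁) (compression J A₂) := by
  have hVS := hV.isRowIsometry.krausSummable
  have hfixed : krausMap V A₁ = A₁ := krausMap_eq_self_of_isSOTLimit hVS h.limit
  have hpure : IsPureSolution (krausMap V) A₂ :=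
    h.eq_adjoint_mul_self ▸ isPureSolution_adjoint_comp_self hVS h.intertwines
  have hnonneg : 0 ≤ compression J A₂ := by
    rw [h.eq_adjoint_mul_self, nonneg_iff_isPositive]
    exact (isPositive_adjoint_comp_self Q).adjoint_conj J.toContinuousLinearMap
  refine ⟨?_, ?_, hnonneg, ?_, h.eq_compression⟩
  · rw [← sub_eq_iff_eq_add.2 h.eq_compression]
    exact hA.sub hnonneg.isSelfAdjoint
  · rw [hV.krausMap_compression, hfixed]
  · exact hpure.adjoint_conj (W := J.toContinuousLinearMap) hV.krausSummable hVS
      fun i x => hV.adjoint_apply i x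

end Representations

end CPMap

end

theorem theorem3p8_general
    {ι : Type u} {H : Type v} [NormedAddCommGroup H] [InnerProductSpace ℂ H] [CompleteSpace H]
    {𝒦 : Type w} [NormedAddCommGroup 𝒦] [InnerProductSpace ℂ 𝒦] [CompleteSpace 𝒦]
    {T : ι → H →L[ℂ] H} {J : H →ₗᵢ[ℂ] 𝒦} {V : ι → 𝒦 →L[ℂ] 𝒦}
    (hV : CPMap.IsIsometricDilation T J V) :
    (∀ B : 𝒦 →L[ℂ] 𝒦, CPMap.InCommutant V B →
      ∃ A₁ : 𝒦 →L[ℂ] 𝒦, CPMap.IsSOTLimit (fun k => (CPMap.krausMap V)^[k] B) A₁) ∧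
    ∀ A : H →L[ℂ] H, 0 ≤ A →
      (CPMap.krausMap T A ≤ A ↔
        ∃ (B : 𝒦 →L[ℂ] 𝒦)
          (D : Type w) (_ : NormedAddCommGroup D) (_ : InnerProductSpace ℂ D)
          (_ : CompleteSpace D) (Q : 𝒦 →L[ℂ] CPMap.Fock ι D) (A₁ A₂ : 𝒦 →L[ℂ] 𝒦),
          CPMap.Represents J V A B Q A₁ A₂) ∧
      (∀ (B : 𝒦 →L[ℂ] 𝒦)
          (D : Type x) [NormedAddCommGroup D] [InnerProductSpace ℂ D]
          [CompleteSpace D] (Q : 𝒦 →L[ℂ] CPMap.Fock ι D) (A₁ A₂ : 𝒦 →L[ℂ] 𝒦),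
          CPMap.Represents J V A B Q A₁ A₂ →
          ∀ A' A'' : H →L[ℂ] H,
            CPMap.IsCanonicalDecomposition (CPMap.krausMap T) A A' A'' ↔
              A' = CPMap.compression J A₁ ∧ A'' = CPMap.compression J A₂) := by
  refine ⟨fun B hB => CPMap.exists_isSOTLimit_krausMap_iterate hV.isRowIsometry.krausSummable
    hV.isRowIsometry.krausMap_one_le hB, fun A hA => ⟨⟨fun hTA => ?_, ?_⟩, ?_⟩⟩
  · obtain ⟨B, Q, A₁, A₂, h⟩ := hV.exists_represents hA hTA
    exact ⟨B, 𝒦, inferInstance, inferInstance, inferInstance, Q, A₁, A₂, h⟩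
  · rintro ⟨B, D, _, _, _, Q, A₁, A₂, h⟩
    exact (h.isCanonicalDecomposition hV hA.isSelfAdjoint).krausMap_le hV.krausSummable
  · intro B D _ _ _ Q A₁ A₂ h A' A''
    have hdecomp := h.isCanonicalDecomposition hV hA.isSelfAdjoint
    refine ⟨fun h' => h'.unique hV.krausSummable hdecomp, ?_⟩
    rintro ⟨rfl, rfl⟩
    exact hdecomp

theorem theorem3p8
    {ι : Type u} [Countable ι] [Nonempty ι]
    {H : Type v} [NormedAddCommGroup H] [InnerProductSpace ℂ H] [CompleteSpace H]
    [TopologicalSpace.SeparableSpace H]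
    {𝒦 : Type w} [NormedAddCommGroup 𝒦] [InnerProductSpace ℂ 𝒦] [CompleteSpace 𝒦]
    (T : ι → H →L[ℂ] H) (hT : CPMap.KrausSummable T) (hT1 : CPMap.krausMap T 1 ≤ 1)
    (J : H →ₗᵢ[ℂ] 𝒦) (V : ι → 𝒦 →L[ℂ] 𝒦) (hV : CPMap.IsMinimalIsometricDilation T J V) :
    -- the limit that defines `A₁` exists for every `B` in the commutant
    (∀ B : 𝒦 →L[ℂ] 𝒦, CPMap.InCommutant V B →
      ∃ A₁ : 𝒦 →L[ℂ] 𝒦, CPMap.IsSOTLimit (fun k => (CPMap.krausMap V)^[k] B) A₁) ∧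
    ∀ A : H →L[ℂ] H, 0 ≤ A →
      -- characterization of the solutions
      (CPMap.krausMap T A ≤ A ↔
        ∃ (B : 𝒦 →L[ℂ] 𝒦)
          (D : Type w) (_ : NormedAddCommGroup D) (_ : InnerProductSpace ℂ D)
          (_ : CompleteSpace D) (Q : 𝒦 →L[ℂ] CPMap.Fock ι D) (A₁ A₂ : 𝒦 →L[ℂ] 𝒦),
          CPMap.Represents J V A B Q A₁ A₂) ∧
      -- every such representation gives the (unique) canonical decomposition
      (∀ (B : 𝒦 →L[ℂ] 𝒦)
          (D : Type x) [NormedAddCommGroup D] [InnerProductSpace ℂ D]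
          [CompleteSpace D] (Q : 𝒦 →L[ℂ] CPMap.Fock ι D) (A₁ A₂ : 𝒦 →L[ℂ] 𝒦),
          CPMap.Represents J V A B Q A₁ A₂ →
          ∀ A' A'' : H →L[ℂ] H,
            CPMap.IsCanonicalDecomposition (CPMap.krausMap T) A A' A'' ↔
              A' = CPMap.compression J A₁ ∧ A'' = CPMap.compression J A₂) :=
  theorem3p8_general hV.isIsometricDilation
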